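/- **Theorem.** Let $X$ be a (Hausdorff, second countable, finite-dimensional) complex manifold and let $\Omega\subsetneq X$ be a domain (a non-empty connected open subset) that is Kobayashi hyperbolic, i.e. its Kobayashi pseudodistance $\mathsf k_\Omega$ is a distance. Fix an exhaustion $(K_j)$ of the closure $\overline\Omega$ of $\Omega$ in $X$ by compact sets, each contained in the interior (in $\overline\Omega$) of the next. *End compactification.* An end of $\overline\Omega$ is a decreasing sequence $(F_j)$ in which each $F_j$ is a connected component of $\overline\Omega\setminus K_j$. Let $\overline\Omega^{\mathrm{End}}$ be the disjoint union of $\overline\Omega$ and the set of its ends. A set $U\subset\overline\Omega^{\mathrm{End}}$ is open if $U\cap\overline\Omega$ is open in $\overline\Omega$ and, for every end $e=(F_j)$ in $U$, there is a $j$ such that $U$ contains $F_j$ and all ends $(G_\nu)$ with $G_\nu=F_\nu$ for all $\nu\le j$. Put $\partial\overline\Omega^{\mathrm{End}}=\overline\Omega^{\mathrm{End}}\setminus\Omega$. Assume that $\overline\Omega^{\mathrm{End}}$ is sequentially compact. *Metric compactification.* Let $C_*(\Omega)$ be the space of real-valued continuous functions on the metric space $(\Omega,\mathsf k_\Omega)$,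 with the topology of uniform convergence on compact sets, modulo the constant functions, with the quotient topology. Let $i_{\mathsf k}(z)=[\mathsf k_\Omega(z,\cdot)]\in C_*(\Omega)$ for $z\in\Omega$, and let $\overline\Omega^{\mathsf k}$ be the closure of $i_{\mathsf k}(\Omega)$ in $C_*(\Omega)$. For $x\in\partial\overline\Omega^{\mathrm{End}}$ let $$\mathscr H(x)=\{\xi\in\overline\Omega^{\mathsf k}\setminus i_{\mathsf k}(\Omega) : \text{there is a sequence } (x_n)\subset\Omega \text{ with } x_n\to x \text{ in } \overline\Omega^{\mathrm{End}} \text{ and } i_{\mathsf k}(x_n)\to\xi\}.$$ Let $o\in\Omega$. Then the following are equivalent: 1. For every $x\in\partial\overline\Omega^{\mathrm{End}}$ and every $z\in\Omega$, the limit $\lim_{w\to x,\,w\in\Omega}\big(\mathsf k_\Omega(z,w)-\mathsf k_\Omega(o,w)\big)$ exists in $\mathbb R$. 2. For every $x\in\partial\overline\Omega^{\mathrm{End}}$, the set $\mathscr H(x)$ has exactly one element. 3. There is a continuous map $G:\overline\Omega^{\mathrm{End}}\to\overline\Omega^{\mathsf k}$ with $G(z)=i_{\mathsf k}(z)$ for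 all $z\in\Omega$. -/

import Mathlib

open Set Filter Topology
open scoped Manifold ContDiff ENNReal

noncomputable section

/-! ### The Kobayashi pseudodistance of a complex manifold -/

section Kobayashi

/-- The Poincare distance of the unit disc (the distance of `|dz| / (1 - |z| ^ 2)`). -/
def poincareDist (a b : ℂ) : ℝ :=
  Real.artanh ‖(a - b) / (1 - (starRingEnd ℂ) b * a)‖

/-- The infimum of the Poincare distances of `a` and `b` over all holomorphic maps `f` from the
unit disc to `M` and all `a`, `b` in the disc with `f a = x` and `f b = y` (it is `∞` if there are
none). A map from the disc is a map on `ℂ`, of which only the values on the disc matter. -/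
def discEDist (E : Type*) [NormedAddCommGroup E] [NormedSpace ℂ E]
    {M : Type*} [TopologicalSpace M] [ChartedSpace E M] (x y : M) : ℝ≥0∞ :=
  ⨅ (f : ℂ → M) (_ : MDifferentiableOn 𝓘(ℂ) 𝓘(ℂ, E) f (Metric.ball 0 1))
    (a : ℂ) (_ : a ∈ Metric.ball (0 : ℂ) 1) (b : ℂ) (_ : b ∈ Metric.ball (0 : ℂ) 1)
    (_ : f a = x) (_ : f b = y), ENNReal.ofReal (poincareDist a b)

/-- The Kobayashi pseudodistance, with values in `[0, ∞]`: the infimum of the lengths of all chains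
of holomorphic discs from `x` to `y`. -/
def kobayashiEDist (E : Type*) [NormedAddCommGroup E] [NormedSpace ℂ E]
    {M : Type*} [TopologicalSpace M] [ChartedSpace E M] (x y : M) : ℝ≥0∞ :=
  ⨅ (m : ℕ) (p : ℕ → M) (_ : p 0 = x) (_ : p m = y),
    ∑ i ∈ Finset.range m, discEDist E (p i) (p (i + 1))

/-- The Kobayashi pseudodistance as a real number (it is finite on connected manifolds, see
`kobayashiEDist_lt_top`). -/
def kobayashiDist (E : Type*) [NormedAddCommGroup E] [NormedSpace ℂ E]
    {M : Type*} [TopologicalSpace M] [ChartedSpace E M] (x y : M) : ℝ :=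
  (kobayashiEDist E x y).toReal

/-- `M` is Kobayashi hyperbolic: the Kobayashi pseudodistance separates points. -/
def IsKobayashiHyperbolic (E : Type*) [NormedAddCommGroup E] [NormedSpace ℂ E]
    (M : Type*) [TopologicalSpace M] [ChartedSpace E M] : Prop :=
  ∀ x y : M, kobayashiEDist E x y = 0 → x = y

section KobayashiLemmas

variable (E : Type*) [NormedAddCommGroup E] [NormedSpace ℂ E]
  {M : Type*} [TopologicalSpace M] [ChartedSpace E M]

theorem kobayashiEDist_le_sum (m : ℕ) (p : ℕ → M) :
    kobayashiEDist E (p 0) (p m) ≤ ∑ i ∈ Finset.range m, discEDist E (p i) (p (i + 1)) :=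
  iInf_le_of_le m <| iInf_le_of_le p <| iInf_le_of_le rfl <| iInf_le_of_le rfl le_rfl

theorem kobayashiEDist_self (x : M) : kobayashiEDist E x x = 0 := by
  have h := kobayashiEDist_le_sum E 0 (fun _ => x)
  simpa using h

theorem kobayashiEDist_le_discEDist (x y : M) : kobayashiEDist E x y ≤ discEDist E x y := by
  have h := kobayashiEDist_le_sum E 1 (fun i => if i = 0 then x else y)
  simpa using h

theorem poincareDist_comm (a b : ℂ) : poincareDist a b = poincareDist b a := by
  unfold poincareDist
  have h : (starRingEnd ℂ) (1 - (starRingEnd ℂ) b * a) = 1 - (starRingEnd ℂ) a * b := by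
    simp [mul_comm]
  rw [norm_div, norm_div, norm_sub_rev, ← h, RCLike.norm_conj]

theorem discEDist_comm_le (x y : M) : discEDist E x y ≤ discEDist E y x := by
  unfold discEDist
  refine le_iInf fun f => le_iInf fun hf => le_iInf fun a => le_iInf fun ha => le_iInf fun b =>
    le_iInf fun hb => le_iInf fun hx => le_iInf fun hy => ?_
  rw [poincareDist_comm]
  exact iInf_le_of_le f <| iInf_le_of_le hf <| iInf_le_of_le b <| iInf_le_of_le hb <|
    iInf_le_of_le a <| iInf_le_of_le ha <| iInf_le_of_le hy <| iInf_le_of_le hx le_rfl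

theorem discEDist_comm (x y : M) : discEDist E x y = discEDist E y x :=
  le_antisymm (discEDist_comm_le E x y) (discEDist_comm_le E y x)

theorem kobayashiEDist_comm_le (x y : M) : kobayashiEDist E x y ≤ kobayashiEDist E y x := by
  conv_rhs => unfold kobayashiEDist
  refine le_iInf fun m => le_iInf fun p => le_iInf fun h0 => le_iInf fun hm => ?_
  have h := kobayashiEDist_le_sum E m (fun i => p (m - i))
  simp only [Nat.sub_zero, Nat.sub_self, h0, hm] at h
  refine h.trans (le_of_eq ?_)
  rw [← Finset.sum_range_reflect]
  refine Finset.sum_congr rfl fun i hi => ?_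
  have hi' := Finset.mem_range.1 hi
  rw [discEDist_comm]
  congr 2 <;> omega

theorem kobayashiEDist_comm (x y : M) : kobayashiEDist E x y = kobayashiEDist E y x :=
  le_antisymm (kobayashiEDist_comm_le E x y) (kobayashiEDist_comm_le E y x)

theorem kobayashiEDist_triangle (x y z : M) :
    kobayashiEDist E x z ≤ kobayashiEDist E x y + kobayashiEDist E y z := by
  conv_rhs => unfold kobayashiEDist
  simp only [ENNReal.iInf_add, ENNReal.add_iInf]
  refine le_iInf fun n => le_iInf fun q => le_iInf fun g0 => le_iInf fun gn =>
    le_iInf fun m => le_iInf fun p => le_iInf fun h0 => le_iInf fun hm => ?_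
  have h := kobayashiEDist_le_sum E (m + n) (fun i => if i ≤ m then p i else q (i - m))
  have e0 : (if 0 ≤ m then p 0 else q (0 - m)) = x := by simp [h0]
  have e1 : (if m + n ≤ m then p (m + n) else q (m + n - m)) = z := by
    rcases Nat.eq_zero_or_pos n with rfl | hn
    · simp [hm, ← gn, g0]
    · simp [gn, hn.ne']
  rw [e0, e1, Finset.sum_range_add] at h
  refine h.trans (le_of_eq ?_)
  congr 1
  · refine Finset.sum_congr rfl fun i hi => ?_
    have hi' := Finset.mem_range.1 hi
    rw [if_pos (by omega), if_pos (by omega)]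
  · refine Finset.sum_congr rfl fun i hi => ?_
    rcases Nat.eq_zero_or_pos i with rfl | hi
    · simp [hm, g0]
    · rw [if_neg (by omega), if_neg (by omega)]
      congr 2 <;> omega

theorem eventually_discEDist_lt_top [IsManifold 𝓘(ℂ, E) ω M] (x : M) :
    ∀ᶠ y in 𝓝 x, discEDist E x y < ⊤ := by
  have : IsManifold 𝓘(ℂ, E) 1 M := IsManifold.of_le (n := ω) le_top
  set e := chartAt E x with he
  obtain ⟨r, hr, hball⟩ := Metric.isOpen_iff.1 e.open_target (e x) (mem_chart_target E x)
  have hc : ContinuousAt e x := e.continuousAt (mem_chart_source E x)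
  have h1 : ∀ᶠ y in 𝓝 x, e y ∈ Metric.ball (e x) (r / 2) :=
    hc (Metric.ball_mem_nhds _ (half_pos hr))
  have h2 : ∀ᶠ y in 𝓝 x, y ∈ e.source := e.open_source.mem_nhds (mem_chart_source E x)
  filter_upwards [h1, h2] with y hy hys
  set v : E := (2 : ℂ) • (e y - e x) with hv
  have hvr : ‖v‖ < r := by
    rw [Metric.mem_ball, dist_eq_norm] at hy
    rw [hv, norm_smul]
    norm_num
    linarith
  have hmaps : MapsTo (fun ζ : ℂ => e x + ζ • v) (Metric.ball 0 1) e.target := by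
    intro ζ hζ
    apply hball
    rw [mem_ball_zero_iff] at hζ
    rw [Metric.mem_ball, dist_eq_norm, add_sub_cancel_left, norm_smul]
    nlinarith [norm_nonneg v, norm_nonneg ζ]
  have hf : MDifferentiableOn 𝓘(ℂ) 𝓘(ℂ, E) (fun ζ : ℂ => e.symm (e x + ζ • v))
      (Metric.ball 0 1) := by
    have hg : MDifferentiableOn 𝓘(ℂ) 𝓘(ℂ, E) (fun ζ : ℂ => e x + ζ • v) (Metric.ball 0 1) := by
      rw [mdifferentiableOn_iff_differentiableOn]
      fun_prop
    exact (mdifferentiableOn_atlas_symm (I := 𝓘(ℂ, E)) (chart_mem_atlas E x)).comp hg hmaps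
  have ha : (0 : ℂ) ∈ Metric.ball (0 : ℂ) 1 := by simp
  have hb : (1 / 2 : ℂ) ∈ Metric.ball (0 : ℂ) 1 := by
    rw [mem_ball_zero_iff]; norm_num
  have hfa : e.symm (e x + (0 : ℂ) • v) = x := by
    simpa using e.left_inv (mem_chart_source E x)
  have hfb : e.symm (e x + (1 / 2 : ℂ) • v) = y := by
    rw [hv, smul_smul]
    norm_num
    exact e.left_inv hys
  refine lt_of_le_of_lt ?_ (ENNReal.ofReal_lt_top (r := poincareDist 0 (1 / 2)))
  exact iInf_le_of_le _ <| iInf_le_of_le hf <| iInf_le_of_le 0 <| iInf_le_of_le ha <|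
    iInf_le_of_le (1 / 2) <| iInf_le_of_le hb <| iInf_le_of_le hfa <| iInf_le_of_le hfb le_rfl

/-- On a connected complex manifold any two points are joined by a chain of holomorphic discs. -/
theorem kobayashiEDist_lt_top [IsManifold 𝓘(ℂ, E) ω M] [ConnectedSpace M] (x y : M) :
    kobayashiEDist E x y < ⊤ := by
  have hnear : ∀ u : M, ∀ᶠ w in 𝓝 u, kobayashiEDist E u w < ⊤ := fun u =>
    (eventually_discEDist_lt_top E u).mono fun w hw =>
      (kobayashiEDist_le_discEDist E u w).trans_lt hw
  have hclopen : IsClopen {w : M | kobayashiEDist E x w < ⊤} := by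
    constructor
    · rw [← isOpen_compl_iff, isOpen_iff_mem_nhds]
      intro u hu
      filter_upwards [hnear u] with w hw hw'
      refine hu ((kobayashiEDist_triangle E x w u).trans_lt ?_)
      rw [kobayashiEDist_comm E w u]
      exact ENNReal.add_lt_top.2 ⟨hw', hw⟩
    · rw [isOpen_iff_mem_nhds]
      intro u hu
      filter_upwards [hnear u] with w hw
      exact (kobayashiEDist_triangle E x u w).trans_lt (ENNReal.add_lt_top.2 ⟨hu, hw⟩)
  have huniv := hclopen.eq_univ ⟨x, by simp [kobayashiEDist_self]⟩
  have hy : y ∈ {w : M | kobayashiEDist E x w < ⊤} := huniv ▸ mem_univ y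
  exact hy

end KobayashiLemmas

/-- A Kobayashi hyperbolic manifold `M`, regarded as the metric space `(M, k_M)`; `of` is the
identity map from `M` to `(M, k_M)`. -/
@[ext]
structure KobayashiSpace (E : Type*) [NormedAddCommGroup E] [NormedSpace ℂ E]
    (M : Type*) [TopologicalSpace M] [ChartedSpace E M]
    (hyp : IsKobayashiHyperbolic E M) where
  of ::
  point : M

instance (E : Type*) [NormedAddCommGroup E] [NormedSpace ℂ E]
    (M : Type*) [TopologicalSpace M] [ChartedSpace E M] [IsManifold 𝓘(ℂ, E) ω M]
    [ConnectedSpace M] (hyp : IsKobayashiHyperbolic E M) :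
    MetricSpace (KobayashiSpace E M hyp) where
  dist x y := kobayashiDist E x.point y.point
  dist_self x := by
    simp [kobayashiDist, kobayashiEDist_self]
  dist_comm x y := by
    simp only [kobayashiDist]
    rw [kobayashiEDist_comm]
  dist_triangle x y z := by
    simp only [kobayashiDist]
    have hxy := (kobayashiEDist_lt_top E x.point y.point).ne
    have hyz := (kobayashiEDist_lt_top E y.point z.point).ne
    rw [← ENNReal.toReal_add hxy hyz]
    exact ENNReal.toReal_mono (ENNReal.add_ne_top.2 ⟨hxy, hyz⟩)
      (kobayashiEDist_triangle E x.point y.point z.point)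
  eq_of_dist_eq_zero {x y} hxy := by
    rcases (ENNReal.toReal_eq_zero_iff _).1 hxy with h0 | h0
    · exact KobayashiSpace.ext (hyp x.point y.point h0)
    · exact absurd h0 (kobayashiEDist_lt_top E x.point y.point).ne

end Kobayashi

/-! ### The metric compactification of a metric space -/

section MetricCompactification

/-- The subspace of constant functions in `C(Y, ℝ)`. -/
def constantFunctions (Y : Type*) [TopologicalSpace Y] : Submodule ℝ C(Y, ℝ) where
  carrier := {f | ∃ c : ℝ, ∀ y, f y = c}
  add_mem' := by
    rintro f g ⟨c, hc⟩ ⟨d, hd⟩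
    exact ⟨c + d, fun y => by simp [hc, hd]⟩
  zero_mem' := ⟨0, fun y => by simp⟩
  smul_mem' := by
    rintro a f ⟨c, hc⟩
    exact ⟨a * c, fun y => by simp [hc]⟩

/-- `C_*(Y)`: continuous functions modulo constants, with the quotient topology of the topology of
uniform convergence on compact sets (the compact-open topology that Mathlib puts on `C(Y, ℝ)`). -/
abbrev ContinuousModConstants (Y : Type*) [TopologicalSpace Y] : Type _ :=
  C(Y, ℝ) ⧸ constantFunctions Y

/-- The map `x ↦ [d(x, ·)]` from `Y` to `C_*(Y)`. -/
def distanceClass (Y : Type*) [MetricSpace Y] (x : Y) : ContinuousModConstants Y :=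
  Submodule.Quotient.mk (⟨fun y => dist x y, by fun_prop⟩ : C(Y, ℝ))

/-- The metric (horofunction) compactification: the closure of the classes of the distance
functions in `C_*(Y)`. -/
abbrev MetricCompactification (Y : Type*) [MetricSpace Y] : Type _ :=
  closure (range (distanceClass Y))

/-- The canonical map `i_d` from `Y` to its metric compactification. -/
def toMetricCompactification (Y : Type*) [MetricSpace Y] (x : Y) : MetricCompactification Y :=
  ⟨distanceClass Y x, subset_closure (mem_range_self x)⟩

end MetricCompactification

/-! ### The end compactification of a space with a compact exhaustion -/

section EndCompactification

/-- An end of `Y`, relative to a compact exhaustion `K`: a decreasing sequence of connected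
components `F j` of `Y \ K j`. -/
structure SpaceEnd {Y : Type*} [TopologicalSpace Y] (K : CompactExhaustion Y) where
  F : ℕ → Set Y
  isComponent : ∀ j, ∃ y ∈ (K j)ᶜ, F j = connectedComponentIn (K j)ᶜ y
  subset_succ : ∀ j, F (j + 1) ⊆ F j

/-- The disjoint union of `Y` and the set of its ends. -/
inductive EndCompactification {Y : Type*} [TopologicalSpace Y] (K : CompactExhaustion Y)
  | pt (y : Y) : EndCompactification K
  | atEnd (e : SpaceEnd K) : EndCompactification K

/-- The basic neighbourhoods of an end `e = (F j)`: the points of `F j` together with all ends whose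
sequences agree with `F` up to the index `j`. -/
def SpaceEnd.basicNhd {Y : Type*} [TopologicalSpace Y] {K : CompactExhaustion Y}
    (e : SpaceEnd K) (j : ℕ) : Set (EndCompactification K) :=
  EndCompactification.pt '' e.F j ∪
    EndCompactification.atEnd '' {f : SpaceEnd K | ∀ i ≤ j, f.F i = e.F i}

theorem SpaceEnd.basicNhd_anti {Y : Type*} [TopologicalSpace Y] {K : CompactExhaustion Y}
    (e : SpaceEnd K) : Antitone e.basicNhd := by
  intro i j hij
  refine union_subset_union (image_mono (antitone_nat_of_succ_le e.subset_succ hij))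
    (image_mono fun f hf l hl => hf l (hl.trans hij))

/-- A set is open if and only if, with each point of `Y`, it contains a neighbourhood of that point
in `Y` and, with each end, it contains a basic neighbourhood of that end. -/
instance {Y : Type*} [TopologicalSpace Y] (K : CompactExhaustion Y) :
    TopologicalSpace (EndCompactification K) where
  IsOpen U := IsOpen (EndCompactification.pt ⁻¹' U) ∧
    ∀ e : SpaceEnd K, EndCompactification.atEnd e ∈ U → ∃ j, e.basicNhd j ⊆ U
  isOpen_univ := ⟨isOpen_univ, fun _ _ => ⟨0, subset_univ _⟩⟩
  isOpen_inter := by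
    rintro U V ⟨hU, hU'⟩ ⟨hV, hV'⟩
    refine ⟨hU.inter hV, fun e he => ?_⟩
    obtain ⟨i, hi⟩ := hU' e he.1
    obtain ⟨j, hj⟩ := hV' e he.2
    exact ⟨max i j, subset_inter ((e.basicNhd_anti (le_max_left i j)).trans hi)
      ((e.basicNhd_anti (le_max_right i j)).trans hj)⟩
  isOpen_sUnion := by
    intro S hS
    refine ⟨?_, ?_⟩
    · rw [preimage_sUnion]
      exact isOpen_biUnion fun U hU => (hS U hU).1
    · rintro e ⟨U, hU, heU⟩
      obtain ⟨j, hj⟩ := (hS U hU).2 e heU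
      exact ⟨j, hj.trans (subset_sUnion_of_mem hU)⟩

end EndCompactification

/-! ### Domains in a complex manifold -/

section Domain

/-- The inclusion of `Ω` into the end compactification of its closure in `X`. -/
def toEndCompactification {X : Type*} [TopologicalSpace X] (Ω : TopologicalSpace.Opens X)
    (K : CompactExhaustion (closure (Ω : Set X))) (z : Ω) : EndCompactification K :=
  EndCompactification.pt ⟨z, subset_closure z.2⟩

/-- The end boundary: the complement of `Ω` in the end compactification of its closure. -/
def endBoundary {X : Type*} [TopologicalSpace X] (Ω : TopologicalSpace.Opens X)
    (K : CompactExhaustion (closure (Ω : Set X))) : Set (EndCompactification K) :=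
  (range (toEndCompactification Ω K))ᶜ

/-- The canonical map `i_k` from a hyperbolic complex manifold `M` to the metric compactification of
`(M, k_M)`. -/
def kobayashiEmbedding {E : Type*} [NormedAddCommGroup E] [NormedSpace ℂ E]
    {M : Type*} [TopologicalSpace M] [ChartedSpace E M] [IsManifold 𝓘(ℂ, E) ω M]
    [ConnectedSpace M] (h : IsKobayashiHyperbolic E M) (z : M) :
    MetricCompactification (KobayashiSpace E M h) :=
  toMetricCompactification (KobayashiSpace E M h) (KobayashiSpace.of z)

/-- The set of metric boundary points that are limits of sequences in `Ω` converging to `x` in the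
end compactification. -/
def horoLimitSet {E : Type*} [NormedAddCommGroup E] [NormedSpace ℂ E]
    {X : Type*} [TopologicalSpace X] [ChartedSpace E X] [IsManifold 𝓘(ℂ, E) ω X]
    {Ω : TopologicalSpace.Opens X} [ConnectedSpace Ω] (h : IsKobayashiHyperbolic E Ω)
    (K : CompactExhaustion (closure (Ω : Set X))) (x : EndCompactification K) :
    Set (MetricCompactification (KobayashiSpace E Ω h)) :=
  {ξ | ξ ∉ range (kobayashiEmbedding h) ∧ ∃ u : ℕ → Ω,
    Tendsto (fun n => toEndCompactification Ω K (u n)) atTop (𝓝 x) ∧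
    Tendsto (fun n => kobayashiEmbedding h (u n)) atTop (𝓝 ξ)}

end Domain

end

/-! ### Geodesics in the disc -/

/-! Consider the normalized distances h_w(z) = k(z,w) - k(o,w). They are 1-Lipschitz in z and
bounded by k(z,o). Hence pointwise convergence of h_w amounts to convergence of i_k(w) in the metric
compactification (`exists_tendsto_toMetricCompactification`), and every sequence in Ω has a
subsequence for which it holds (`exists_subseq_tendsto_dist_sub`). So (1) says that i_k has a limit
at each end boundary point, and extension by continuity from the dense subset Ω gives (3). Under
(3), i_k(w) tends to G(x) as w tends to x, which gives (2). Under (2), all subsequential limits at x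
coincide, so i_k converges at x, which gives (1). Two difficulties remain.

The limits at x must lie outside i_k(Ω), since H(x) excludes this image
(`not_tendsto_kobayashi_sub_of_le_cocompact`). The Kobayashi distance is almost a length: chains of
disc radii join p to w, and one of them meets the sphere of small radius ε about p in a point c with
k(c,w) ≤ k(p,w) - ε/2. If i_k(w) tended to i_k(p), then k(·,w) - k(p,w) would tend to ε uniformly on
that sphere, which is compact by hyperbolicity: a contradiction. Completeness plays no role.

Passing between filters and sequences needs first countability of the end compactification. A
component of the complement of K j need not be open, as the closure of Ω need not be locally
connected. Sequential compactness repairs this: only finitely many components at level j belong to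
ends, and they cover the complement of some K m, so each is open outside K m
(`SpaceEnd.exists_isOpen_diff`). -/

theorem Complex.norm_add_lt_norm_one_add {a z : ℂ} (ha : ‖a‖ < 1) (hz : ‖z‖ < 1) :
    ‖z + a‖ < ‖1 + (starRingEnd ℂ) a * z‖ := by
  have key : Complex.normSq (1 + (starRingEnd ℂ) a * z) - Complex.normSq (z + a) =
      (1 - Complex.normSq a) * (1 - Complex.normSq z) := by
    simp [Complex.normSq_apply]
    ring
  rw [Complex.normSq_eq_norm_sq, Complex.normSq_eq_norm_sq, Complex.normSq_eq_norm_sq,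
    Complex.normSq_eq_norm_sq] at key
  have h1 : 0 < 1 - ‖a‖ ^ 2 := by nlinarith [norm_nonneg a]
  have h2 : 0 < 1 - ‖z‖ ^ 2 := by nlinarith [norm_nonneg z]
  refine lt_of_pow_lt_pow_left₀ 2 (norm_nonneg _) ?_
  linarith [mul_pos h1 h2]

theorem Complex.one_add_conj_mul_ne_zero {a z : ℂ} (ha : ‖a‖ < 1) (hz : ‖z‖ < 1) :
    1 + (starRingEnd ℂ) a * z ≠ 0 :=
  norm_pos_iff.1 ((norm_nonneg _).trans_lt (Complex.norm_add_lt_norm_one_add ha hz))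

/-- A disc automorphism which moves `0` to `a` and a point at pseudohyperbolic distance of `a` and
`b` from `0` to `b`. -/
theorem exists_disc_automorphism {a b : ℂ} (ha : ‖a‖ < 1) (hb : ‖b‖ < 1) :
    ∃ φ : ℂ → ℂ, DifferentiableOn ℂ φ (Metric.ball 0 1) ∧
      MapsTo φ (Metric.ball 0 1) (Metric.ball 0 1) ∧ φ 0 = a ∧
      ∃ c : ℂ, ‖c‖ < 1 ∧ φ c = b ∧ poincareDist a b = Real.artanh ‖c‖ := by
  have hna : ‖-a‖ < 1 := by rwa [norm_neg]
  have hne := Complex.one_add_conj_mul_ne_zero hna hb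
  have hane : 1 - (starRingEnd ℂ) a * a ≠ 0 := by
    simpa [sub_eq_add_neg] using Complex.one_add_conj_mul_ne_zero hna ha
  refine ⟨fun z => (z + a) / (1 + (starRingEnd ℂ) a * z), ?_, ?_, by simp,
    (b - a) / (1 - (starRingEnd ℂ) a * b), ?_, ?_, ?_⟩
  · intro z hz
    have := Complex.one_add_conj_mul_ne_zero ha (mem_ball_zero_iff.1 hz)
    apply DifferentiableAt.differentiableWithinAt
    fun_prop (disch := assumption)
  · intro z hz
    rw [mem_ball_zero_iff] at hz ⊢
    have h := Complex.norm_add_lt_norm_one_add ha hz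
    rw [norm_div, div_lt_one ((norm_nonneg _).trans_lt h)]
    exact h
  · have h := Complex.norm_add_lt_norm_one_add hna hb
    rw [norm_div]
    simp only [map_neg, neg_mul, ← sub_eq_add_neg] at h
    rw [div_lt_one ((norm_nonneg _).trans_lt h)]
    exact h
  · have hne' : 1 - (starRingEnd ℂ) a * b ≠ 0 := by simpa [sub_eq_add_neg] using hne
    have h2 : 1 + (starRingEnd ℂ) a * ((b - a) / (1 - (starRingEnd ℂ) a * b)) =
        (1 - (starRingEnd ℂ) a * a) / (1 - (starRingEnd ℂ) a * b) := by
      rw [eq_div_iff hne', add_mul, mul_assoc, div_mul_cancel₀ _ hne']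
      ring
    have h3 : (b - a) / (1 - (starRingEnd ℂ) a * b) + a =
        b * (1 - (starRingEnd ℂ) a * a) / (1 - (starRingEnd ℂ) a * b) := by
      rw [eq_div_iff hne', add_mul, div_mul_cancel₀ _ hne']
      ring
    simp only [h2, h3]
    rw [div_div_div_cancel_right₀ hne', mul_div_cancel_right₀ _ hane]
  · rw [poincareDist_comm]
    rfl

/-- Hyperbolic length is additive along the radius through 0, tr and r; the second argument is the
pseudohyperbolic distance of tr and r. After taking logarithms it is a rational identity. -/
theorem Real.artanh_mul_add_artanh {r t : ℝ} (h0 : 0 ≤ r) (h1 : r < 1) (ht : t ∈ Icc (0 : ℝ) 1) :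
    Real.artanh (t * r) + Real.artanh ((1 - t) * r / (1 - t * r ^ 2)) = Real.artanh r := by
  obtain ⟨ht0, ht1⟩ := ht
  have htr0 : 0 ≤ t * r := mul_nonneg ht0 h0
  have htr1 : t * r < 1 := by nlinarith
  have hd : 0 < 1 - t * r ^ 2 := by nlinarith
  have hs0 : 0 ≤ (1 - t) * r / (1 - t * r ^ 2) :=
    div_nonneg (mul_nonneg (by linarith) h0) hd.le
  have hs1 : (1 - t) * r / (1 - t * r ^ 2) < 1 := by
    rw [div_lt_one hd]
    nlinarith [mul_nonneg htr0 (sub_nonneg.2 h1.le)]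
  rw [Real.artanh_eq_half_log ⟨by linarith, htr1.le⟩, Real.artanh_eq_half_log ⟨by linarith, hs1.le⟩,
    Real.artanh_eq_half_log ⟨by linarith, h1.le⟩, ← mul_add, ← Real.log_mul]
  · congr 2
    have e1 : 1 - t * r ≠ 0 := by linarith
    have e2 : 1 - r ≠ 0 := by linarith
    have e3 : 1 - (1 - t) * r / (1 - t * r ^ 2) ≠ 0 := by linarith
    have e4 := hd.ne'
    have e5 : 1 - t * r ^ 2 - (1 - t) * r = (1 - r) * (1 + t * r) := by ring
    have e6 : (1 + t * r) ≠ 0 := by linarith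
    have e7 : 1 - (1 - t) * r / (1 - t * r ^ 2) = (1 - r) * (1 + t * r) / (1 - t * r ^ 2) := by
      rw [← e5]; field_simp
    rw [e7]
    field_simp
    ring
  · exact (div_pos (by linarith) (by linarith)).ne'
  · exact (div_pos (by linarith) (by linarith)).ne'

theorem poincareDist_smul_right {c : ℂ} (hc : ‖c‖ < 1) {t : ℝ} (ht : t ∈ Icc (0 : ℝ) 1) :
    poincareDist (t * c) c = Real.artanh ((1 - t) * ‖c‖ / (1 - t * ‖c‖ ^ 2)) := by
  have hd : 0 < 1 - t * ‖c‖ ^ 2 := by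
    nlinarith [norm_nonneg c, ht.1, ht.2, mul_nonneg ht.1 (sq_nonneg ‖c‖)]
  unfold poincareDist
  congr 1
  have e1 : (t : ℂ) * c - c = ((t - 1 : ℝ) : ℂ) * c := by push_cast; ring
  have e2 : 1 - (starRingEnd ℂ) c * (t * c) = ((1 - t * ‖c‖ ^ 2 : ℝ) : ℂ) := by
    push_cast
    rw [← Complex.conj_mul']
    ring
  rw [e1, e2, norm_div, norm_mul, Complex.norm_real, Complex.norm_real, Real.norm_of_nonneg hd.le,
    Real.norm_of_nonpos (by linarith [ht.2]), neg_sub]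

/-! ### Almost geodesic connected sets -/

section Geodesics

variable (E : Type*) [NormedAddCommGroup E] [NormedSpace ℂ E]
  {M : Type*} [TopologicalSpace M] [ChartedSpace E M]

theorem discEDist_le {f : ℂ → M} (hf : MDifferentiableOn 𝓘(ℂ) 𝓘(ℂ, E) f (Metric.ball 0 1))
    {a b : ℂ} (ha : ‖a‖ < 1) (hb : ‖b‖ < 1) :
    discEDist E (f a) (f b) ≤ ENNReal.ofReal (poincareDist a b) :=
  iInf_le_of_le f <| iInf_le_of_le hf <| iInf_le_of_le a <|
    iInf_le_of_le (mem_ball_zero_iff.2 ha) <| iInf_le_of_le b <|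
    iInf_le_of_le (mem_ball_zero_iff.2 hb) <| iInf_le_of_le rfl <| iInf_le_of_le rfl le_rfl

/-- There is a connected set through `x` and `y` along which the detour is at most `s`. -/
def HasConnectingSet (x y : M) (s : ℝ≥0∞) : Prop :=
  ∃ S : Set M, IsPreconnected S ∧ x ∈ S ∧ y ∈ S ∧
    ∀ c ∈ S, kobayashiEDist E x c + kobayashiEDist E c y ≤ s

variable {E} in
theorem HasConnectingSet.mono {x y : M} {s t : ℝ≥0∞} (h : HasConnectingSet E x y s)
    (hst : s ≤ t) : HasConnectingSet E x y t := by
  obtain ⟨S, hS, hx, hy, h⟩ := h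
  exact ⟨S, hS, hx, hy, fun c hc => (h c hc).trans hst⟩

theorem hasConnectingSet_self (x : M) : HasConnectingSet E x x 0 :=
  ⟨{x}, isPreconnected_singleton, rfl, rfl, by
    rintro c rfl
    simp [kobayashiEDist_self]⟩

variable {E} in
-- The two sets share y, so their union is connected. From a point in either set, the remaining leg
-- is estimated by passing through y.
theorem HasConnectingSet.trans {x y z : M} {s t : ℝ≥0∞} (h : HasConnectingSet E x y s)
    (h' : HasConnectingSet E y z t) : HasConnectingSet E x z (s + t) := by
  obtain ⟨S, hS, hx, hy, hs⟩ := h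
  obtain ⟨T, hT, hy', hz, ht⟩ := h'
  have hxy : kobayashiEDist E x y ≤ s := by simpa [kobayashiEDist_self] using hs y hy
  have hyz : kobayashiEDist E y z ≤ t := by simpa [kobayashiEDist_self] using ht y hy'
  refine ⟨S ∪ T, hS.union y hy hy' hT, Or.inl hx, Or.inr hz, ?_⟩
  rintro c (hc | hc)
  · calc kobayashiEDist E x c + kobayashiEDist E c z
        ≤ kobayashiEDist E x c + (kobayashiEDist E c y + kobayashiEDist E y z) := by
          gcongr; exact kobayashiEDist_triangle E c y z
      _ = kobayashiEDist E x c + kobayashiEDist E c y + kobayashiEDist E y z := by rw [add_assoc]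
      _ ≤ s + t := add_le_add (hs c hc) hyz
  · calc kobayashiEDist E x c + kobayashiEDist E c z
        ≤ (kobayashiEDist E x y + kobayashiEDist E y c) + kobayashiEDist E c z := by
          gcongr; exact kobayashiEDist_triangle E x y c
      _ = kobayashiEDist E x y + (kobayashiEDist E y c + kobayashiEDist E c z) := by rw [add_assoc]
      _ ≤ s + t := add_le_add hxy (ht c hc)

/-- A disc automorphism moves a to 0. The image of the radius ending at the parameter of b then
works, because the lengths of its two pieces add up exactly. -/
theorem hasConnectingSet_of_disc {f : ℂ → M}
    (hf : MDifferentiableOn 𝓘(ℂ) 𝓘(ℂ, E) f (Metric.ball 0 1)) {a b : ℂ} (ha : ‖a‖ < 1)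
    (hb : ‖b‖ < 1) : HasConnectingSet E (f a) (f b) (ENNReal.ofReal (poincareDist a b)) := by
  obtain ⟨φ, hφ, hmaps, h0, c, hc, hcb, hdist⟩ := exists_disc_automorphism ha hb
  have hg : MDifferentiableOn 𝓘(ℂ) 𝓘(ℂ, E) (f ∘ φ) (Metric.ball 0 1) :=
    hf.comp (mdifferentiableOn_iff_differentiableOn.2 hφ) hmaps
  have hball : MapsTo (fun t : ℝ => (t : ℂ) * c) (Icc 0 1) (Metric.ball 0 1) := by
    intro t ht
    rw [mem_ball_zero_iff, norm_mul, Complex.norm_real, Real.norm_of_nonneg ht.1]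
    nlinarith [norm_nonneg c, ht.2]
  refine ⟨(fun t : ℝ => (f ∘ φ) (t * c)) '' Icc 0 1, ?_, ⟨0, by simp, by simp [h0]⟩,
    ⟨1, by simp, by simp [hcb]⟩, ?_⟩
  · refine isPreconnected_Icc.image _ (hg.continuousOn.comp ?_ hball)
    fun_prop
  · rintro _ ⟨t, ht, rfl⟩
    have htc := mem_ball_zero_iff.1 (hball ht)
    have k1 : kobayashiEDist E (f a) ((f ∘ φ) (t * c)) ≤ ENNReal.ofReal (Real.artanh (t * ‖c‖)) := by
      have := (kobayashiEDist_le_discEDist E _ _).trans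
        (discEDist_le E hg (a := 0) (b := t * c) (by simp) htc)
      rw [poincareDist_comm] at this
      simpa [poincareDist, h0, abs_of_nonneg ht.1] using this
    have k2 : kobayashiEDist E ((f ∘ φ) (t * c)) (f b) ≤
        ENNReal.ofReal (Real.artanh ((1 - t) * ‖c‖ / (1 - t * ‖c‖ ^ 2))) := by
      have := (kobayashiEDist_le_discEDist E _ _).trans (discEDist_le E hg htc hc)
      rw [poincareDist_smul_right hc ht] at this
      simpa [hcb] using this
    refine (add_le_add k1 k2).trans (le_of_eq ?_)
    rw [← ENNReal.ofReal_add, Real.artanh_mul_add_artanh (norm_nonneg c) hc ht, hdist]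
    · exact Real.artanh_nonneg (mul_nonneg ht.1 (norm_nonneg c))
    · refine Real.artanh_nonneg (div_nonneg (mul_nonneg (by linarith [ht.2]) (norm_nonneg c)) ?_)
      nlinarith [norm_nonneg c, ht.2, ht.1, mul_nonneg ht.1 (sq_nonneg ‖c‖)]

theorem hasConnectingSet_of_discEDist_lt {x y : M} {s : ℝ≥0∞} (h : discEDist E x y < s) :
    HasConnectingSet E x y s := by
  simp only [discEDist, iInf_lt_iff] at h
  obtain ⟨f, hf, a, ha, b, hb, rfl, rfl, h⟩ := h
  exact (hasConnectingSet_of_disc E hf (mem_ball_zero_iff.1 ha) (mem_ball_zero_iff.1 hb)).mono h.le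

/-- The slack ε is needed because the infimum defining each disc distance may not be attained; half
of it goes to the last link and half to the rest. -/
theorem hasConnectingSet_chain (m : ℕ) (p : ℕ → M) {ε : ℝ≥0∞} (hε : ε ≠ 0)
    (hp : ∀ i < m, discEDist E (p i) (p (i + 1)) ≠ ⊤) :
    HasConnectingSet E (p 0) (p m)
      (∑ i ∈ Finset.range m, discEDist E (p i) (p (i + 1)) + ε) := by
  induction m generalizing ε with
  | zero => exact (hasConnectingSet_self E (p 0)).mono bot_le
  | succ m ih =>
    have hε2 : ε / 2 ≠ 0 := (ENNReal.half_pos hε).ne'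
    have h2 := (ih hε2 fun i hi => hp i (hi.trans m.lt_succ_self)).trans
      (hasConnectingSet_of_discEDist_lt E (ENNReal.lt_add_right (hp m m.lt_succ_self) hε2))
    refine h2.mono (le_of_eq ?_)
    rw [Finset.sum_range_succ, add_add_add_comm, ENNReal.add_halves]

theorem hasConnectingSet_of_kobayashiEDist_lt {x y : M} {r : ℝ≥0∞}
    (h : kobayashiEDist E x y < r) : HasConnectingSet E x y r := by
  simp only [kobayashiEDist, iInf_lt_iff] at h
  obtain ⟨m, p, rfl, rfl, h⟩ := h
  refine (hasConnectingSet_chain E m p (tsub_pos_of_lt h).ne' fun i hi => ?_).mono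
    (add_tsub_cancel_of_le h.le).le
  exact ne_top_of_le_ne_top h.ne_top
    (Finset.single_le_sum (f := fun i => discEDist E (p i) (p (i + 1))) (fun _ _ => zero_le)
      (Finset.mem_range.2 hi))

end Geodesics

/-! ### The topology of the Kobayashi distance -/

section KobayashiTopology

variable (E : Type*) [NormedAddCommGroup E] [NormedSpace ℂ E]
  {M : Type*} [TopologicalSpace M] [ChartedSpace E M] [IsManifold 𝓘(ℂ, E) ω M]

/-- In a chart, the affine disc centred at x that reaches y at parameter 1/N stays in the chart once
y is N times closer to x than the chart's boundary. -/
theorem eventually_discEDist_le_artanh (x : M) (N : ℕ) (hN : 2 ≤ N) :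
    ∀ᶠ y in 𝓝 x, discEDist E x y ≤ ENNReal.ofReal (Real.artanh (1 / N)) := by
  have : IsManifold 𝓘(ℂ, E) 1 M := IsManifold.of_le (n := ω) le_top
  have hN0 : (0 : ℝ) < N := by positivity
  set e := chartAt E x with he
  obtain ⟨r, hr, hball⟩ := Metric.isOpen_iff.1 e.open_target (e x) (mem_chart_target E x)
  have hc : ContinuousAt e x := e.continuousAt (mem_chart_source E x)
  have h1 : ∀ᶠ y in 𝓝 x, e y ∈ Metric.ball (e x) (r / N) :=
    hc (Metric.ball_mem_nhds _ (by positivity))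
  have h2 : ∀ᶠ y in 𝓝 x, y ∈ e.source := e.open_source.mem_nhds (mem_chart_source E x)
  filter_upwards [h1, h2] with y hy hys
  set v : E := (N : ℂ) • (e y - e x) with hv
  have hvr : ‖v‖ < r := by
    rw [Metric.mem_ball, dist_eq_norm, lt_div_iff₀ hN0] at hy
    rw [hv, norm_smul, Complex.norm_natCast]
    linarith
  have hmaps : MapsTo (fun ζ : ℂ => e x + ζ • v) (Metric.ball 0 1) e.target := by
    intro ζ hζ
    apply hball
    rw [mem_ball_zero_iff] at hζ
    rw [Metric.mem_ball, dist_eq_norm, add_sub_cancel_left, norm_smul]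
    nlinarith [norm_nonneg v, norm_nonneg ζ]
  have hf : MDifferentiableOn 𝓘(ℂ) 𝓘(ℂ, E) (fun ζ : ℂ => e.symm (e x + ζ • v))
      (Metric.ball 0 1) := by
    have hg : MDifferentiableOn 𝓘(ℂ) 𝓘(ℂ, E) (fun ζ : ℂ => e x + ζ • v) (Metric.ball 0 1) := by
      rw [mdifferentiableOn_iff_differentiableOn]
      fun_prop
    exact (mdifferentiableOn_atlas_symm (I := 𝓘(ℂ, E)) (chart_mem_atlas E x)).comp hg hmaps
  have hb : ‖(1 / N : ℂ)‖ < 1 := by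
    rw [norm_div, norm_one, Complex.norm_natCast, div_lt_one hN0]
    exact_mod_cast hN
  have hfa : e.symm (e x + (0 : ℂ) • v) = x := by
    simpa using e.left_inv (mem_chart_source E x)
  have hfb : e.symm (e x + (1 / N : ℂ) • v) = y := by
    have : (N : ℂ) ≠ 0 := by exact_mod_cast hN0.ne'
    rw [hv, smul_smul, one_div_mul_cancel this, one_smul, add_sub_cancel]
    exact e.left_inv hys
  have h := discEDist_le E hf (a := 0) (b := 1 / N) (by simp) hb
  simp only [hfa, hfb] at h
  simpa [poincareDist] using h

theorem tendsto_kobayashiEDist_self (x : M) :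
    Tendsto (fun y => kobayashiEDist E x y) (𝓝 x) (𝓝 0) := by
  have hcont : Tendsto Real.artanh (𝓝 0) (𝓝 0) := by
    have : ContinuousAt Real.artanh 0 := by
      unfold Real.artanh
      refine ContinuousAt.log ?_ (by simp)
      exact (ContinuousAt.div (by fun_prop) (by fun_prop) (by simp)).sqrt
    simpa using this.tendsto
  have h1 : Tendsto (fun N : ℕ => ENNReal.ofReal (Real.artanh (1 / N))) atTop (𝓝 0) := by
    simpa using ENNReal.tendsto_ofReal (hcont.comp tendsto_one_div_atTop_nhds_zero_nat)
  rw [ENNReal.tendsto_nhds_zero]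
  intro ε hε
  obtain ⟨N, hN, hN2⟩ := ((ENNReal.tendsto_nhds_zero.1 h1 ε hε).and (eventually_ge_atTop 2)).exists
  filter_upwards [eventually_discEDist_le_artanh E x N hN2] with y hy
  exact (kobayashiEDist_le_discEDist E x y).trans (hy.trans hN)

variable [ConnectedSpace M]

variable (hyp : IsKobayashiHyperbolic E M)

theorem KobayashiSpace.continuous_of :
    Continuous (KobayashiSpace.of : M → KobayashiSpace E M hyp) := by
  rw [continuous_iff_continuousAt]
  intro x
  rw [ContinuousAt, tendsto_iff_dist_tendsto_zero]
  have h := (ENNReal.tendsto_toReal ENNReal.zero_ne_top).comp (tendsto_kobayashiEDist_self E x)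
  refine h.congr fun y => ?_
  rw [dist_comm]
  rfl

theorem IsPreconnected.inter_frontier_nonempty_of_mem {X : Type*} [TopologicalSpace X]
    {S U : Set X} (hS : IsPreconnected S) {p q : X} (hp : p ∈ S) (hpU : p ∈ U) (hq : q ∈ S)
    (hqU : q ∉ U) : (S ∩ frontier U).Nonempty := by
  by_contra hcon
  have hfr : ∀ c ∈ S, c ∉ frontier U := fun c hc hcf => hcon ⟨c, hc, hcf⟩
  have hint : ∀ c ∈ S, c ∈ U → c ∈ interior U := fun c hc hcU =>
    by_contra fun h => hfr c hc ⟨subset_closure hcU, h⟩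
  have hext : ∀ c ∈ S, c ∉ U → c ∈ (closure U)ᶜ := fun c hc hcU h =>
    hfr c hc ⟨h, fun h' => hcU (interior_subset h')⟩
  obtain ⟨c, -, hc1, hc2⟩ := hS (interior U) (closure U)ᶜ isOpen_interior
    isClosed_closure.isOpen_compl
    (fun c hc => (em (c ∈ U)).imp (hint c hc) (hext c hc)) ⟨p, hp, hint p hp hpU⟩
    ⟨q, hq, hext q hq hqU⟩
  exact hc2 (subset_closure (interior_subset hc1))

variable {E}

open KobayashiSpace in
/-- Points of a connected set from `x` to `y` along which the detour is at most `r`. -/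
theorem exists_connecting_set {x y : M} {r : ℝ}
    (h : dist (of x : KobayashiSpace E M hyp) (of y) < r) :
    ∃ S : Set M, IsPreconnected S ∧ x ∈ S ∧ y ∈ S ∧ ∀ c ∈ S,
      dist (of x : KobayashiSpace E M hyp) (of c) +
        dist (of c : KobayashiSpace E M hyp) (of y) ≤ r := by
  have hr : 0 < r := dist_nonneg.trans_lt h
  have h' : kobayashiEDist E x y < ENNReal.ofReal r :=
    (ENNReal.lt_ofReal_iff_toReal_lt (kobayashiEDist_lt_top E x y).ne).2 h
  obtain ⟨S, hS, hx, hy, hs⟩ := hasConnectingSet_of_kobayashiEDist_lt E h'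
  refine ⟨S, hS, hx, hy, fun c hc => ?_⟩
  have := ENNReal.toReal_mono ENNReal.ofReal_ne_top (hs c hc)
  rwa [ENNReal.toReal_add (kobayashiEDist_lt_top E _ _).ne (kobayashiEDist_lt_top E _ _).ne,
    ENNReal.toReal_ofReal hr.le] at this

open KobayashiSpace in
-- This is the intermediate value theorem for the distance from x on an almost geodesic connecting
-- set.
theorem exists_dist_eq_of_lt {x y : M} {ε r : ℝ} (hε : 0 ≤ ε)
    (hεy : ε ≤ dist (of x : KobayashiSpace E M hyp) (of y))
    (h : dist (of x : KobayashiSpace E M hyp) (of y) < r) :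
    ∃ c : M, dist (of x : KobayashiSpace E M hyp) (of c) = ε ∧
      ε + dist (of c : KobayashiSpace E M hyp) (of y) ≤ r := by
  obtain ⟨S, hS, hx, hy, hs⟩ := exists_connecting_set hyp h
  have hcont : Continuous fun c : M => dist (of x : KobayashiSpace E M hyp) (of c) :=
    continuous_const.dist (continuous_of E hyp)
  obtain ⟨c, hc, hce⟩ := hS.intermediate_value hx hy hcont.continuousOn
    ⟨by simpa using hε, hεy⟩
  exact ⟨c, hce, hce ▸ hs c hc⟩

open KobayashiSpace in
/-- On a hyperbolic manifold, small balls of the Kobayashi distance are relatively compact. -/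
theorem exists_isCompact_kobayashi_closedBall [T2Space M] [LocallyCompactSpace M] (p : M) :
    ∃ ε > 0, IsCompact {q : M | dist (of p : KobayashiSpace E M hyp) (of q) ≤ ε} := by
  obtain ⟨U, hU, hpU⟩ := exists_compact_mem_nhds p
  have hcont : Continuous fun c : M => dist (of p : KobayashiSpace E M hyp) (of c) :=
    continuous_const.dist (continuous_of E hyp)
  have hfr : IsCompact (frontier U) := hU.of_isClosed_subset isClosed_frontier
    (frontier_subset_iff_isClosed.2 hU.isClosed)
  -- δ is the least distance from p to the compact frontier, positive by hyperbolicity. A connecting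
  -- set that leaves U must cross the frontier, so its detour is at least δ.
  obtain ⟨δ, hδ, hδU⟩ : ∃ δ > 0, ∀ c ∈ frontier U,
      δ ≤ dist (of p : KobayashiSpace E M hyp) (of c) := by
    rcases (frontier U).eq_empty_or_nonempty with he | hne
    · exact ⟨1, one_pos, by simp [he]⟩
    · obtain ⟨c, hc, hmin⟩ := hfr.exists_isMinOn hne hcont.continuousOn
      refine ⟨_, dist_pos.2 fun h => ?_, hmin⟩
      have hpc : p = c := congrArg KobayashiSpace.point h
      exact hc.2 (hpc ▸ mem_interior_iff_mem_nhds.2 hpU)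
  refine ⟨δ / 2, half_pos hδ, hU.of_isClosed_subset (isClosed_le hcont continuous_const) ?_⟩
  intro q hq
  by_contra hqU
  obtain ⟨S, hS, hpS, hqS, hs⟩ := exists_connecting_set hyp
    (lt_of_le_of_lt hq (show δ / 2 < δ * (3 / 4) by linarith))
  obtain ⟨c, hcS, hc⟩ := hS.inter_frontier_nonempty_of_mem hpS (mem_of_mem_nhds hpU) hqS hqU
  have := hs c hcS
  have := hδU c hc
  have : 0 ≤ dist (of c : KobayashiSpace E M hyp) (of q) := dist_nonneg
  linarith

open KobayashiSpace in
/-- Along a filter that leaves all compact sets, the normalized distance functions do not converge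
to the one of a point. -/
theorem not_tendsto_kobayashi_sub_of_le_cocompact [T2Space M] [LocallyCompactSpace M]
    {l : Filter M} [l.NeBot] (hl : l ≤ cocompact M) (p : M) :
    ¬ ∀ z : M, Tendsto (fun w => dist (of w : KobayashiSpace E M hyp) (of z) -
      dist (of w : KobayashiSpace E M hyp) (of p)) l
      (𝓝 (dist (of p : KobayashiSpace E M hyp) (of z))) := by
  intro h
  obtain ⟨ε, hε, hB⟩ := exists_isCompact_kobayashi_closedBall hyp p
  have hcont : Continuous (of : M → KobayashiSpace E M hyp) := continuous_of E hyp
  set S := {q : M | dist (of p : KobayashiSpace E M hyp) (of q) = ε} with hSdef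
  have hS : IsCompact S := hB.of_isClosed_subset
    (isClosed_eq (continuous_const.dist hcont) continuous_const) fun q hq => le_of_eq hq
  -- Pointwise convergence to ε becomes a uniform bound on the compact sphere: at a centre z the
  -- difference exceeds 3ε/4, and within distance ε/4 of z it drops by less than ε/4.
  have key : ∀ᶠ w in l, ∀ z ∈ S, ε / 2 < dist (of w : KobayashiSpace E M hyp) (of z) -
      dist (of w : KobayashiSpace E M hyp) (of p) := by
    refine hS.induction_on (p := fun T => ∀ᶠ w in l, ∀ z ∈ T,
      ε / 2 < dist (of w : KobayashiSpace E M hyp) (of z) -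
        dist (of w : KobayashiSpace E M hyp) (of p)) (by simp) ?_ ?_ ?_
    · intro s t hst ht
      exact ht.mono fun w hw z hz => hw z (hst hz)
    · intro s t hs ht
      filter_upwards [hs, ht] with w h1 h2 z hz
      exact hz.elim (h1 z) (h2 z)
    · intro z hz
      refine ⟨{z' | dist (of z : KobayashiSpace E M hyp) (of z') < ε / 4},
        mem_nhdsWithin_of_mem_nhds ((isOpen_lt (continuous_const.dist hcont)
          continuous_const).mem_nhds (by simpa using hε)), ?_⟩
      have hz' := h z
      rw [show dist (of p : KobayashiSpace E M hyp) (of z) = ε from hz] at hz'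
      filter_upwards [hz'.eventually_const_lt (show ε * (3 / 4) < ε by linarith)] with w hw z₁ hz₁
      have h3 : dist (of z : KobayashiSpace E M hyp) (of z₁) < ε / 4 := hz₁
      have h4 := dist_triangle (of w : KobayashiSpace E M hyp) (of z₁) (of z)
      rw [dist_comm (of z₁ : KobayashiSpace E M hyp)] at h4
      linarith
  obtain ⟨w, hw, hwB⟩ := (key.and (hl hB.compl_mem_cocompact)).exists
  have hwε : ε < dist (of p : KobayashiSpace E M hyp) (of w) := by simpa using hwB
  -- The almost geodesic from p to w meets the sphere at a point where the difference is at most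
  -- -ε/2, against `key`.
  obtain ⟨c, hc, hcw⟩ := exists_dist_eq_of_lt hyp hε.le hwε.le
    (show _ < dist (of p : KobayashiSpace E M hyp) (of w) + ε / 2 by linarith)
  have := hw c hc
  rw [dist_comm (of w : KobayashiSpace E M hyp) (of c),
    dist_comm (of w : KobayashiSpace E M hyp) (of p)] at this
  linarith

end KobayashiTopology

/-! ### Convergence in the metric compactification -/

section MetricCompactification

variable {Y : Type*}

/-- The function on classes modulo constants that sends `[f]` to `f z - f o`. -/
def ContinuousModConstants.evalSub [TopologicalSpace Y] (o z : Y) :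
    ContinuousModConstants Y → ℝ :=
  Quotient.lift (fun f : C(Y, ℝ) => f z - f o) (by
    intro f g hfg
    obtain ⟨c, hc⟩ := (Submodule.quotientRel_def _).1 hfg
    have hz := hc z
    have ho := hc o
    simp only [ContinuousMap.sub_apply] at hz ho
    linarith)

theorem ContinuousModConstants.evalSub_mk [TopologicalSpace Y] (o z : Y) (f : C(Y, ℝ)) :
    evalSub o z (Submodule.Quotient.mk f : ContinuousModConstants Y) = f z - f o := rfl

theorem ContinuousModConstants.continuous_evalSub [TopologicalSpace Y] (o z : Y) :
    Continuous (evalSub o z : ContinuousModConstants Y → ℝ) :=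
  Continuous.quotient_lift (by fun_prop) _

theorem ContinuousModConstants.ext_evalSub [TopologicalSpace Y] (o : Y)
    {ξ η : ContinuousModConstants Y} (h : ∀ z, evalSub o z ξ = evalSub o z η) : ξ = η := by
  induction ξ using Submodule.Quotient.induction_on with | _ f
  induction η using Submodule.Quotient.induction_on with | _ g
  refine (Submodule.Quotient.eq _).2 ⟨f o - g o, fun y => ?_⟩
  have := h y
  simp only [evalSub_mk] at this
  simp only [ContinuousMap.sub_apply]
  linarith

/-- The differences f z - f o determine the class of f, so the quotient injects continuously into a
product of lines. -/
theorem ContinuousModConstants.t2Space [TopologicalSpace Y] (o : Y) :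
    T2Space (ContinuousModConstants Y) :=
  .of_injective_continuous (f := fun ξ z => evalSub o z ξ)
    (fun _ _ h => ext_evalSub o (congrFun h)) (continuous_pi fun z => continuous_evalSub o z)

variable [MetricSpace Y]

theorem evalSub_distanceClass (o z x : Y) :
    ContinuousModConstants.evalSub o z (distanceClass Y x) = dist x z - dist x o := rfl

/-- A uniformly Lipschitz family is equicontinuous, and on such a family pointwise convergence is
uniform on compact sets. -/
theorem LipschitzWith.tendsto_continuousMap {ι : Type*} {l : Filter ι} {F : ι → C(Y, ℝ)}
    {f : C(Y, ℝ)} {C : NNReal} (hF : ∀ i, LipschitzWith C (F i))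
    (h : ∀ z, Tendsto (fun i => F i z) l (𝓝 (f z))) : Tendsto F l (𝓝 f) := by
  have heq : UniformEquicontinuous fun i => (F i : Y → ℝ) :=
    LipschitzWith.uniformEquicontinuous _ C hF
  rw [ContinuousMap.tendsto_iff_forall_isCompact_tendstoUniformlyOn]
  have := (EquicontinuousOn.tendsto_uniformOnFun_iff_pi (𝔖 := {K : Set Y | IsCompact K})
    (fun K hK => hK) (eq_univ_of_forall fun y => ⟨{y}, isCompact_singleton, rfl⟩)
    (fun K _ => heq.equicontinuous.equicontinuousOn K) l f).2 (tendsto_pi_nhds.2 h)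
  exact UniformOnFun.tendsto_iff_tendstoUniformlyOn.1 this

/-- If the normalized distance functions converge pointwise, then the classes of the distance
functions converge in the metric compactification. -/
theorem exists_tendsto_toMetricCompactification {ι : Type*} {l : Filter ι} [l.NeBot] {u : ι → Y}
    (o : Y) (h : ∀ z, ∃ L : ℝ, Tendsto (fun i => dist (u i) z - dist (u i) o) l (𝓝 L)) :
    ∃ ξ : MetricCompactification Y,
      Tendsto (fun i => toMetricCompactification Y (u i)) l (𝓝 ξ) := by
  choose L hL using h
  have hlip : ∀ x : Y, LipschitzWith 1 fun z => dist x z - dist x o := fun x => by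
    refine LipschitzWith.of_dist_le_mul fun y z => ?_
    simp only [Real.dist_eq, NNReal.coe_one, one_mul, sub_sub_sub_cancel_right]
    rw [dist_comm x y, dist_comm x z]
    exact abs_dist_sub_le y z x
  have hLlip : LipschitzWith 1 L := by
    refine LipschitzWith.of_dist_le_mul fun y z => ?_
    exact le_of_tendsto ((hL y).dist (hL z)) (.of_forall fun i => (hlip (u i)).dist_le_mul y z)
  have hconv : Tendsto (fun i => (⟨_, (hlip (u i)).continuous⟩ : C(Y, ℝ))) l
      (𝓝 ⟨L, hLlip.continuous⟩) :=
    LipschitzWith.tendsto_continuousMap (fun i => hlip (u i)) hL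
  have hmk : Continuous (Submodule.Quotient.mk : C(Y, ℝ) → ContinuousModConstants Y) :=
    continuous_quot_mk
  have hcl : Tendsto (fun i => distanceClass Y (u i)) l
      (𝓝 (Submodule.Quotient.mk ⟨L, hLlip.continuous⟩)) := by
    refine ((hmk.tendsto _).comp hconv).congr fun i => ?_
    exact ContinuousModConstants.ext_evalSub o fun z => by
      simp [ContinuousModConstants.evalSub_mk, evalSub_distanceClass]
  exact ⟨⟨_, mem_closure_of_tendsto hcl (.of_forall fun i => mem_range_self (u i))⟩,
    tendsto_subtype_rng.2 hcl⟩

theorem continuous_toMetricCompactification : Continuous (toMetricCompactification Y) := by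
  rw [continuous_iff_continuousAt]
  intro x
  obtain ⟨ξ, hξ⟩ := exists_tendsto_toMetricCompactification (l := 𝓝 x) (u := id) x fun z =>
    ⟨dist x z - dist x x, (by fun_prop : Continuous fun y => dist y z - dist y x).tendsto x⟩
  have := ContinuousModConstants.t2Space x
  replace hξ : Tendsto (toMetricCompactification Y) (𝓝 x) (𝓝 ξ) := hξ
  -- Restricting to the constant filter at x identifies ξ as the image of x.
  have h1 : Tendsto (toMetricCompactification Y) (pure x) (𝓝 ξ) := hξ.mono_left (pure_le_nhds x)
  rwa [tendsto_nhds_unique h1 (tendsto_pure_nhds _ x)] at hξ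

/-- A Hausdorff topological group is regular, and so are its subspaces. Extension by continuity
needs a regular target. -/
theorem MetricCompactification.t3Space (o : Y) : T3Space (MetricCompactification Y) := by
  have := ContinuousModConstants.t2Space o
  infer_instance

/-- Arzelà–Ascoli: on a countable dense set the values lie in a countable product of compact
intervals, and the Lipschitz bound carries convergence to all other points. -/
theorem exists_subseq_tendsto_dist_sub [TopologicalSpace.SeparableSpace Y] (o : Y) (u : ℕ → Y) :
    ∃ φ : ℕ → ℕ, StrictMono φ ∧
      ∀ z, ∃ L : ℝ, Tendsto (fun n => dist (u (φ n)) z - dist (u (φ n)) o) atTop (𝓝 L) := by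
  obtain ⟨D, hD, hDd⟩ := TopologicalSpace.exists_countable_dense Y
  have : Countable D := hD.to_subtype
  have hmem : ∀ n, (fun z : D => dist (u n) z - dist (u n) o) ∈
      (univ : Set D).pi fun z => Icc (-dist (z : Y) o) (dist (z : Y) o) := by
    intro n z _
    have h1 := dist_triangle (u n) z o
    have h2 := dist_triangle (u n) o z
    rw [dist_comm o (z : Y)] at h2
    constructor <;> linarith
  obtain ⟨a, -, φ, hφ, ha⟩ := (isCompact_univ_pi fun z : D =>
    isCompact_Icc (a := -dist (z : Y) o) (b := dist (z : Y) o)).tendsto_subseq hmem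
  refine ⟨φ, hφ, fun z => cauchySeq_tendsto_of_complete ?_⟩
  rw [Metric.cauchySeq_iff']
  intro ε hε
  obtain ⟨d, hdD, hd⟩ := hDd.exists_dist_lt z (show 0 < ε / 4 by linarith)
  have hc := (tendsto_pi_nhds.1 ha ⟨d, hdD⟩).cauchySeq
  obtain ⟨N, hN⟩ := Metric.cauchySeq_iff'.1 hc (ε / 4) (by linarith)
  refine ⟨N, fun n hn => ?_⟩
  have h1 := hN n hn
  simp only [Function.comp_apply, Real.dist_eq] at h1 ⊢
  have h2 := abs_le.1 (abs_dist_sub_le z d (u (φ n)))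
  have h3 := abs_le.1 (abs_dist_sub_le z d (u (φ N)))
  rw [dist_comm z (u (φ n)), dist_comm d (u (φ n))] at h2
  rw [dist_comm z (u (φ N)), dist_comm d (u (φ N))] at h3
  rw [abs_lt] at h1 ⊢
  constructor <;> linarith

end MetricCompactification

/-! ### The topology of the end compactification -/

section EndCompactification

variable {Y : Type*} [TopologicalSpace Y] {K : CompactExhaustion Y}

open EndCompactification

theorem EndCompactification.isOpen_def {U : Set (EndCompactification K)} :
    IsOpen U ↔ IsOpen (pt ⁻¹' U) ∧ ∀ e : SpaceEnd K, atEnd e ∈ U → ∃ j, e.basicNhd j ⊆ U :=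
  Iff.rfl

theorem EndCompactification.isOpenEmbedding_pt :
    IsOpenEmbedding (pt : Y → EndCompactification K) := by
  have hinj : Function.Injective (pt : Y → EndCompactification K) := fun x y h => by
    injection h
  refine .of_continuous_injective_isOpenMap ⟨fun U hU => hU.1⟩ hinj fun V hV => ?_
  refine isOpen_def.2 ⟨by rwa [preimage_image_eq _ hinj], ?_⟩
  rintro e ⟨y, -, hy⟩
  cases hy

theorem SpaceEnd.eq_of_F_eq {e f : SpaceEnd K} (h : e.F = f.F) : e = f := by
  cases e
  cases f
  congr

theorem SpaceEnd.antitone (e : SpaceEnd K) : Antitone e.F := antitone_nat_of_succ_le e.subset_succ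

theorem SpaceEnd.subset_compl (e : SpaceEnd K) (j : ℕ) : e.F j ⊆ (K j)ᶜ := by
  obtain ⟨y, -, hy⟩ := e.isComponent j
  exact hy ▸ connectedComponentIn_subset _ _

theorem SpaceEnd.nonempty (e : SpaceEnd K) (j : ℕ) : (e.F j).Nonempty := by
  obtain ⟨y, hy, h⟩ := e.isComponent j
  exact ⟨y, h ▸ mem_connectedComponentIn hy⟩

theorem SpaceEnd.pt_mem_basicNhd {e : SpaceEnd K} {j : ℕ} {y : Y} :
    pt y ∈ e.basicNhd j ↔ y ∈ e.F j := by
  simp [SpaceEnd.basicNhd]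

theorem SpaceEnd.atEnd_mem_basicNhd {e f : SpaceEnd K} {j : ℕ} :
    atEnd f ∈ e.basicNhd j ↔ ∀ i ≤ j, f.F i = e.F i := by
  simp [SpaceEnd.basicNhd]

theorem SpaceEnd.eq_of_mem {e f : SpaceEnd K} {j : ℕ} {y : Y} (he : y ∈ e.F j) (hf : y ∈ f.F j) :
    e.F j = f.F j := by
  obtain ⟨a, -, ha⟩ := e.isComponent j
  obtain ⟨b, -, hb⟩ := f.isComponent j
  rw [ha] at he ⊢
  rw [hb] at hf ⊢
  rw [connectedComponentIn_eq he, connectedComponentIn_eq hf]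

/-- Components are relatively closed: a connected set stays connected when limit points are added.
-/
theorem SpaceEnd.closure_inter_compl_subset (e : SpaceEnd K) (j : ℕ) :
    closure (e.F j) ∩ (K j)ᶜ ⊆ e.F j := by
  obtain ⟨a, ha, h⟩ := e.isComponent j
  have hpre : IsPreconnected (e.F j) := h ▸ isPreconnected_connectedComponentIn
  have haF : a ∈ e.F j := h ▸ mem_connectedComponentIn ha
  have hsub : e.F j ⊆ closure (e.F j) ∩ (K j)ᶜ := subset_inter subset_closure (e.subset_compl j)
  conv_rhs => rw [h]
  exact (hpre.subset_closure hsub inter_subset_left).subset_connectedComponentIn (hsub haF)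
    inter_subset_right

theorem EndCompactification.isClosed_image_pt [T2Space Y] {C : Set Y} (hC : IsCompact C) :
    IsClosed (pt '' C : Set (EndCompactification K)) := by
  rw [← isOpen_compl_iff, isOpen_def]
  refine ⟨?_, fun e _ => ?_⟩
  · rw [preimage_compl, preimage_image_eq _ isOpenEmbedding_pt.injective]
    exact hC.isClosed.isOpen_compl
  · obtain ⟨j, hj⟩ := K.exists_superset_of_isCompact hC
    refine ⟨j, ?_⟩
    rintro x hx ⟨y, hy, rfl⟩
    exact e.subset_compl j (SpaceEnd.pt_mem_basicNhd.1 hx) (hj hy)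

theorem EndCompactification.denseRange_pt : DenseRange (pt : Y → EndCompactification K) := by
  intro x
  rw [mem_closure_iff]
  intro U hU hx
  cases x with
  | pt y => exact ⟨pt y, hx, y, rfl⟩
  | atEnd e =>
    obtain ⟨j, hj⟩ := hU.2 e hx
    obtain ⟨y, hy⟩ := e.nonempty j
    exact ⟨pt y, hj (SpaceEnd.pt_mem_basicNhd.2 hy), y, rfl⟩

/-- A sequence that leaves all compact sets and has an accumulation point in the end
compactification meets a component of some end. -/
theorem exists_mem_end_of_tendsto_cocompact [T2Space Y] [SeqCompactSpace (EndCompactification K)]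
    (j : ℕ) {y : ℕ → Y} (hy : ∀ n, y n ∉ K n) : ∃ n, ∃ e : SpaceEnd K, y n ∈ e.F j := by
  by_contra! hcon
  have hfin : ∀ i, {n | y n ∈ K i} ⊆ Iio i := fun i n hn =>
    lt_of_not_ge fun hin => hy n (K.subset hin hn)
  have hclosed : IsClosed (range y) := by
    have hloc : LocallyFinite fun n => ({y n} : Set Y) := fun x => by
      obtain ⟨i, hi⟩ := K.exists_mem_nhds x
      refine ⟨K i, hi, (finite_Iio i).subset fun n hn => hfin i ?_⟩
      obtain ⟨_, rfl, h⟩ := hn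
      exact h
    rw [← iUnion_singleton_eq_range]
    exact hloc.isClosed_iUnion fun n => isClosed_singleton
  obtain ⟨a, φ, hφ, ha⟩ := SeqCompactSpace.tendsto_subseq fun n => (pt (y n) : EndCompactification K)
  -- By `hcon`, the level j neighbourhood of every end misses the sequence. Removing the sequence
  -- thus leaves an open set containing all ends, and no end can be a limit.
  have hU : IsOpen (pt '' (range y) : Set (EndCompactification K))ᶜ := by
    refine isOpen_def.2 ⟨?_, fun e _ => ⟨j, ?_⟩⟩
    · rw [preimage_compl, preimage_image_eq _ isOpenEmbedding_pt.injective]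
      exact hclosed.isOpen_compl
    · rintro x hx ⟨_, ⟨n, rfl⟩, rfl⟩
      exact hcon n e (SpaceEnd.pt_mem_basicNhd.1 hx)
  cases a with
  | pt a =>
    obtain ⟨i, hi⟩ := K.exists_mem_nhds a
    have h1 : ∀ᶠ n in atTop, pt (y (φ n)) ∈ (pt '' K i : Set (EndCompactification K)) :=
      ha (isOpenEmbedding_pt.image_mem_nhds.2 hi)
    obtain ⟨n, hn, hni⟩ := (h1.and (eventually_ge_atTop i)).exists
    rw [isOpenEmbedding_pt.injective.mem_set_image] at hn
    exact absurd (hfin i hn) (not_lt.2 (hni.trans (hφ.id_le n)))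
  | atEnd e =>
    obtain ⟨n, hn⟩ := (ha.eventually_mem (hU.mem_nhds (by simp))).exists
    exact hn ⟨_, ⟨_, rfl⟩, rfl⟩

theorem exists_compl_subset_iUnion_ends [T2Space Y] [SeqCompactSpace (EndCompactification K)]
    (j : ℕ) : ∃ m, j ≤ m ∧ ∀ y ∉ K m, ∃ e : SpaceEnd K, y ∈ e.F j := by
  by_contra! hcon
  choose! y hy hye using fun m => hcon (max j m) (le_max_left j m)
  obtain ⟨n, e, he⟩ := exists_mem_end_of_tendsto_cocompact (K := K) j (y := y)
    fun n hn => hy n (K.subset (le_max_right j n) hn)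
  exact hye n e he

theorem finite_range_ends [SeqCompactSpace (EndCompactification K)] (j : ℕ) :
    (range fun e : SpaceEnd K => e.F j).Finite := by
  by_contra hinf
  obtain ⟨s, hs⟩ : ∃ s : ℕ → range (fun e : SpaceEnd K => e.F j), Function.Injective s :=
    have := infinite_coe_iff.2 hinf
    ⟨_, (Infinite.natEmbedding _).injective⟩
  choose f hf using fun n => (s n).2
  have hinj : ∀ m n, (f m).F j = (f n).F j → m = n := fun m n h =>
    hs (Subtype.ext ((hf m).symm.trans (h.trans (hf n))))
  obtain ⟨a, φ, hφ, ha⟩ := SeqCompactSpace.tendsto_subseq fun n => (atEnd (f n))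
  cases a with
  | pt a =>
    obtain ⟨n, hn⟩ := (ha.eventually_mem (isOpenEmbedding_pt.isOpen_range.mem_nhds (mem_range_self a))).exists
    obtain ⟨y, hy⟩ := hn
    cases hy
  | atEnd e =>
    -- This removes those f n whose level j component differs from that of e. It is a neighbourhood
    -- of e, so two terms of the subsequence would share the component of e. Openness is checked
    -- directly, since basic neighbourhoods are not yet known to be neighbourhoods: at most one f n
    -- shares the level j component of g, and a deeper level separates it from g.
    have hU : IsOpen {x | ∀ n, x = atEnd (f n) → (f n).F j = e.F j} := by
      refine isOpen_def.2 ⟨?_, fun g hg => ?_⟩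
      · convert isOpen_univ
        exact eq_univ_of_forall fun y n h => by cases h
      · by_cases hgn : ∃ n, (f n).F j = g.F j
        · obtain ⟨n, hn⟩ := hgn
          by_cases hgf : g = f n
          · subst hgf
            refine ⟨j, fun x hx m hm => ?_⟩
            subst hm
            rw [SpaceEnd.atEnd_mem_basicNhd] at hx
            rw [hx j le_rfl]
            exact hg n rfl
          · obtain ⟨i, hi⟩ : ∃ i, g.F i ≠ (f n).F i := by
              by_contra! h
              exact hgf (SpaceEnd.eq_of_F_eq (funext h))
            refine ⟨max i j, fun x hx m hm => ?_⟩
            subst hm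
            rw [SpaceEnd.atEnd_mem_basicNhd] at hx
            have hmn := hinj m n ((hx j (le_max_right i j)).trans hn.symm)
            subst hmn
            exact absurd (hx i (le_max_left i j)).symm hi
        · refine ⟨j, fun x hx m hm => ?_⟩
          subst hm
          rw [SpaceEnd.atEnd_mem_basicNhd] at hx
          exact absurd ⟨m, hx j le_rfl⟩ hgn
    have hev := ha (hU.mem_nhds (fun n h => by injection h with h; rw [h]))
    obtain ⟨N, hN⟩ := eventually_atTop.1 hev
    have h1 := hN N le_rfl _ rfl
    have h2 := hN (N + 1) N.le_succ _ rfl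
    have := hφ.injective (hinj _ _ (h1.trans h2.symm))
    omega

/-- Outside K m, the component is what remains after removing the closures of the finitely many
other end components of level j. -/
theorem SpaceEnd.exists_isOpen_diff [T2Space Y] [SeqCompactSpace (EndCompactification K)] (j : ℕ) :
    ∃ m, j ≤ m ∧ ∀ e : SpaceEnd K, IsOpen (e.F j \ K m) := by
  obtain ⟨m, hjm, hm⟩ := exists_compl_subset_iUnion_ends (K := K) j
  refine ⟨m, hjm, fun e => ?_⟩
  have hfin : ({C | C ∈ range (fun f : SpaceEnd K => f.F j) ∧ C ≠ e.F j}).Finite :=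
    (finite_range_ends j).subset fun C hC => hC.1
  have heq : e.F j \ K m =
      (K m)ᶜ \ ⋃ C ∈ {C | C ∈ range (fun f : SpaceEnd K => f.F j) ∧ C ≠ e.F j}, closure C := by
    ext y
    simp only [Set.mem_sdiff, mem_compl_iff, mem_iUnion, not_exists]
    constructor
    · rintro ⟨hy, hym⟩
      refine ⟨hym, ?_⟩
      rintro _ ⟨⟨f, rfl⟩, hne⟩ hyc
      exact hne (SpaceEnd.eq_of_mem (f.closure_inter_compl_subset j ⟨hyc, e.subset_compl j hy⟩) hy)
    · rintro ⟨hym, hy⟩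
      refine ⟨?_, hym⟩
      obtain ⟨f, hf⟩ := hm y hym
      by_contra hye
      exact hy (f.F j) ⟨⟨f, rfl⟩, fun h => hye (h ▸ hf)⟩ (subset_closure hf)
  rw [heq]
  exact (K.isCompact m).isClosed.isOpen_compl.sdiff
    (hfin.isClosed_biUnion fun _ _ => isClosed_closure)

theorem SpaceEnd.basicNhd_mem_nhds [T2Space Y] [SeqCompactSpace (EndCompactification K)]
    (e : SpaceEnd K) (j : ℕ) : e.basicNhd j ∈ 𝓝 (atEnd e) := by
  obtain ⟨m, hjm, hm⟩ := SpaceEnd.exists_isOpen_diff (K := K) j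
  -- Only the points in K m are discarded. Each end in the set keeps its own level m neighbourhood,
  -- which avoids K m.
  have hU : IsOpen (pt '' (e.F j \ K m) ∪ atEnd '' {f : SpaceEnd K | ∀ i ≤ j, f.F i = e.F i}) := by
    refine isOpen_def.2 ⟨?_, fun f hf => ⟨m, ?_⟩⟩
    · convert hm e using 1
      ext y
      simp
    · have hf' : ∀ i ≤ j, f.F i = e.F i := by simpa using hf
      rintro (y | g) hx
      · rw [SpaceEnd.pt_mem_basicNhd] at hx
        exact Or.inl ⟨y, ⟨hf' j le_rfl ▸ f.antitone hjm hx, f.subset_compl m hx⟩, rfl⟩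
      · rw [SpaceEnd.atEnd_mem_basicNhd] at hx
        exact Or.inr ⟨g, fun i hi => (hx i (hi.trans hjm)).trans (hf' i hi), rfl⟩
  refine mem_of_superset (hU.mem_nhds (Or.inr ⟨e, fun _ _ => rfl, rfl⟩)) ?_
  exact union_subset_union_left _ (image_mono sdiff_subset)

theorem EndCompactification.firstCountableTopology [T2Space Y] [FirstCountableTopology Y]
    [SeqCompactSpace (EndCompactification K)] :
    FirstCountableTopology (EndCompactification K) := by
  refine ⟨fun x => ?_⟩
  cases x with
  | pt y =>
    rw [← isOpenEmbedding_pt.map_nhds_eq]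
    infer_instance
  | atEnd e =>
    refine (HasAntitoneBasis.mk (s := e.basicNhd) ⟨fun U => ⟨fun hU => ?_, ?_⟩⟩
      e.basicNhd_anti).isCountablyGenerated
    · obtain ⟨V, hVU, hV, he⟩ := mem_nhds_iff.1 hU
      obtain ⟨j, hj⟩ := hV.2 e he
      exact ⟨j, trivial, hj.trans hVU⟩
    · rintro ⟨j, -, hj⟩
      exact mem_of_superset (e.basicNhd_mem_nhds j) hj

end EndCompactification

/-! ### Domains -/

section Domain

variable {X : Type*} [TopologicalSpace X] (Ω : TopologicalSpace.Opens X)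
  (K : CompactExhaustion (closure (Ω : Set X)))

theorem isOpenEmbedding_toEndCompactification :
    IsOpenEmbedding (toEndCompactification Ω K) := by
  refine EndCompactification.isOpenEmbedding_pt.comp
    ⟨IsEmbedding.inclusion (subset_closure (s := (Ω : Set X))), ?_⟩
  change IsOpen (range (inclusion (subset_closure (s := (Ω : Set X)))))
  rw [range_inclusion]
  exact Ω.isOpen.preimage continuous_subtype_val

theorem denseRange_toEndCompactification : DenseRange (toEndCompactification Ω K) := by
  refine EndCompactification.denseRange_pt.comp (f := inclusion (subset_closure (s := (Ω : Set X))))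
    (g := EndCompactification.pt) ?_ EndCompactification.isOpenEmbedding_pt.continuous
  intro y
  rw [range_inclusion, closure_subtype]
  convert y.2 using 2
  exact image_preimage_eq_of_subset (by simpa using subset_closure)

/-- A compact subset of Ω has closed image in the end compactification, so a boundary point has a
neighbourhood missing it. -/
theorem comap_toEndCompactification_le_cocompact [T2Space X] {x : EndCompactification K}
    (hx : x ∈ endBoundary Ω K) : comap (toEndCompactification Ω K) (𝓝 x) ≤ cocompact Ω := by
  rw [(hasBasis_cocompact).ge_iff]
  intro C hC
  have hc : IsClosed (toEndCompactification Ω K '' C) := by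
    have h := EndCompactification.isClosed_image_pt (K := K)
      (hC.image (continuous_inclusion (subset_closure (s := (Ω : Set X)))))
    rwa [image_image] at h
  refine ⟨_, hc.isOpen_compl.mem_nhds fun h => hx (image_subset_range _ _ h), ?_⟩
  intro w hw hwC
  exact hw (mem_image_of_mem _ hwC)

end Domain

/-! ### The Kobayashi embedding into the metric compactification -/

section KobayashiCompactification

variable {E : Type*} [NormedAddCommGroup E] [NormedSpace ℂ E]
  {M : Type*} [TopologicalSpace M] [ChartedSpace E M] [IsManifold 𝓘(ℂ, E) ω M]
  [ConnectedSpace M] (hyp : IsKobayashiHyperbolic E M)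

theorem continuous_kobayashiEmbedding : Continuous (kobayashiEmbedding hyp) :=
  continuous_toMetricCompactification.comp (KobayashiSpace.continuous_of E hyp)

theorem evalSub_kobayashiEmbedding (o z w : M) :
    ContinuousModConstants.evalSub (KobayashiSpace.of o) (KobayashiSpace.of z)
      (kobayashiEmbedding hyp w : ContinuousModConstants (KobayashiSpace E M hyp)) =
    dist (KobayashiSpace.of w : KobayashiSpace E M hyp) (KobayashiSpace.of z) -
      dist (KobayashiSpace.of w : KobayashiSpace E M hyp) (KobayashiSpace.of o) := rfl

variable {hyp} in
theorem tendsto_dist_sub_of_tendsto_kobayashiEmbedding {ι : Type*} {l : Filter ι} {u : ι → M}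
    {ξ : MetricCompactification (KobayashiSpace E M hyp)}
    (h : Tendsto (fun i => kobayashiEmbedding hyp (u i)) l (𝓝 ξ)) (o z : M) :
    Tendsto (fun i => kobayashiDist E z (u i) - kobayashiDist E o (u i)) l
      (𝓝 (ContinuousModConstants.evalSub (KobayashiSpace.of o) (KobayashiSpace.of z) ξ.1)) := by
  refine (((ContinuousModConstants.continuous_evalSub _ _).comp continuous_subtype_val).tendsto
    ξ |>.comp h).congr fun i => ?_
  simp only [Function.comp_apply]
  rw [evalSub_kobayashiEmbedding, dist_comm, dist_comm (KobayashiSpace.of (u i))]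
  rfl

theorem not_mem_range_kobayashiEmbedding_of_tendsto [T2Space M] [LocallyCompactSpace M]
    {l : Filter M} [l.NeBot] (hl : l ≤ cocompact M)
    {ξ : MetricCompactification (KobayashiSpace E M hyp)}
    (h : Tendsto (kobayashiEmbedding hyp) l (𝓝 ξ)) : ξ ∉ range (kobayashiEmbedding hyp) := by
  rintro ⟨p, rfl⟩
  refine not_tendsto_kobayashi_sub_of_le_cocompact hyp hl p fun z => ?_
  have := tendsto_dist_sub_of_tendsto_kobayashiEmbedding h p z
  rw [evalSub_kobayashiEmbedding, dist_self, sub_zero] at this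
  refine this.congr fun w => ?_
  rw [dist_comm, dist_comm (KobayashiSpace.of w)]
  rfl

theorem exists_tendsto_kobayashiEmbedding {ι : Type*} {l : Filter ι} [l.NeBot] {u : ι → M} (o : M)
    (h : ∀ z, ∃ L : ℝ, Tendsto (fun i => kobayashiDist E z (u i) - kobayashiDist E o (u i)) l
      (𝓝 L)) :
    ∃ ξ, Tendsto (fun i => kobayashiEmbedding hyp (u i)) l (𝓝 ξ) := by
  refine exists_tendsto_toMetricCompactification (u := fun i => KobayashiSpace.of (u i))
    (KobayashiSpace.of o : KobayashiSpace E M hyp) fun z => ?_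
  obtain ⟨L, hL⟩ := h z.point
  refine ⟨L, hL.congr fun i => ?_⟩
  rw [dist_comm, dist_comm (KobayashiSpace.of (u i))]
  rfl

theorem exists_subseq_tendsto_kobayashiEmbedding [SecondCountableTopology M] (o : M) (u : ℕ → M) :
    ∃ φ : ℕ → ℕ, StrictMono φ ∧
      ∃ ξ, Tendsto (fun n => kobayashiEmbedding hyp (u (φ n))) atTop (𝓝 ξ) := by
  have hsurj : Function.Surjective (KobayashiSpace.of : M → KobayashiSpace E M hyp) :=
    fun y => ⟨y.point, rfl⟩
  have : TopologicalSpace.SeparableSpace (KobayashiSpace E M hyp) :=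
    hsurj.denseRange.separableSpace (KobayashiSpace.continuous_of E hyp)
  obtain ⟨φ, hφ, h⟩ := exists_subseq_tendsto_dist_sub
    (KobayashiSpace.of o : KobayashiSpace E M hyp) fun n => KobayashiSpace.of (u n)
  exact ⟨φ, hφ, exists_tendsto_toMetricCompactification
    (KobayashiSpace.of o : KobayashiSpace E M hyp) h⟩

end KobayashiCompactification

/-! ### The equivalence -/

theorem mainTheorem9 {E : Type*} [NormedAddCommGroup E] [NormedSpace ℂ E] [FiniteDimensional ℂ E]
    {X : Type*} [TopologicalSpace X] [T2Space X] [SecondCountableTopology X]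
    [ChartedSpace E X] [IsManifold 𝓘(ℂ, E) ω X]
    (Ω : TopologicalSpace.Opens X) [ConnectedSpace Ω] (hΩ : (Ω : Set X) ≠ univ)
    (hyp : IsKobayashiHyperbolic E Ω)
    (K : CompactExhaustion (closure (Ω : Set X))) [SeqCompactSpace (EndCompactification K)]
    (o : Ω) :
    List.TFAE [
      ∀ x ∈ endBoundary Ω K, ∀ z : Ω, ∃ L : ℝ,
        Tendsto (fun w : Ω => kobayashiDist E z w - kobayashiDist E o w)
          (comap (toEndCompactification Ω K) (𝓝 x)) (𝓝 L),
      ∀ x ∈ endBoundary Ω K, ∃ ξ, horoLimitSet hyp K x = {ξ},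
      ∃ G : EndCompactification K → MetricCompactification (KobayashiSpace E Ω hyp),
        Continuous G ∧ ∀ z : Ω, G (toEndCompactification Ω K z) = kobayashiEmbedding hyp z] := by
  have : ProperSpace E := FiniteDimensional.proper ℂ E
  have : LocallyCompactSpace X := ChartedSpace.locallyCompactSpace E X
  have : LocallyCompactSpace Ω := Ω.isOpen.locallyCompactSpace
  have := EndCompactification.firstCountableTopology (K := K)
  have : T3Space (MetricCompactification (KobayashiSpace E Ω hyp)) :=
    MetricCompactification.t3Space (KobayashiSpace.of o)
  have hdi : IsDenseInducing (toEndCompactification Ω K) :=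
    ⟨(isOpenEmbedding_toEndCompactification Ω K).isInducing, denseRange_toEndCompactification Ω K⟩
  have hne : ∀ x, (comap (toEndCompactification Ω K) (𝓝 x)).NeBot := fun x => hdi.comap_nhds_neBot x
  tfae_have 1 → 3 := by
    intro h
    have hlim : ∀ x, ∃ ξ, Tendsto (kobayashiEmbedding hyp)
        (comap (toEndCompactification Ω K) (𝓝 x)) (𝓝 ξ) := by
      intro x
      by_cases hx : x ∈ endBoundary Ω K
      · exact exists_tendsto_kobayashiEmbedding hyp o (u := id) (h x hx)
      · obtain ⟨z, rfl⟩ := not_not.1 hx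
        rw [← hdi.nhds_eq_comap]
        exact ⟨_, (continuous_kobayashiEmbedding hyp).tendsto z⟩
    exact ⟨hdi.extend (kobayashiEmbedding hyp), hdi.continuous_extend hlim,
      fun z => hdi.extend_eq (continuous_kobayashiEmbedding hyp) z⟩
  tfae_have 3 → 2 := by
    rintro ⟨G, hG, hGi⟩ x hx
    have hseq : ∀ {l : Filter Ω}, Tendsto (toEndCompactification Ω K) l (𝓝 x) →
        Tendsto (kobayashiEmbedding hyp) l (𝓝 (G x)) := fun hl =>
      ((hG.tendsto x).comp hl).congr hGi
    refine ⟨G x, eq_singleton_iff_unique_mem.2 ⟨⟨?_, ?_⟩, ?_⟩⟩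
    · exact not_mem_range_kobayashiEmbedding_of_tendsto hyp
        (comap_toEndCompactification_le_cocompact Ω K hx) (hseq tendsto_comap)
    · obtain ⟨u, hu⟩ := exists_seq_tendsto (comap (toEndCompactification Ω K) (𝓝 x))
      exact ⟨u, (tendsto_comap (f := toEndCompactification Ω K)).comp hu, (hseq tendsto_comap).comp hu⟩
    · rintro ξ ⟨-, u, hu, huξ⟩
      exact tendsto_nhds_unique huξ ((hseq tendsto_comap).comp (tendsto_comap_iff.2 hu))
  tfae_have 2 → 1 := by
    intro h x hx z
    obtain ⟨ξ, hξ⟩ := h x hx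
    refine ⟨ContinuousModConstants.evalSub (KobayashiSpace.of o) (KobayashiSpace.of z) ξ.1,
      tendsto_dist_sub_of_tendsto_kobayashiEmbedding (u := id) ?_ o z⟩
    -- By countable generation, sequences suffice. Every subsequence has a further one along which
    -- i_k converges, and its limit lies in H(x), hence equals ξ.
    refine tendsto_of_seq_tendsto fun u hu => tendsto_of_subseq_tendsto fun ns hns => ?_
    have hns' := hu.comp hns
    obtain ⟨φ, hφ, η, hη⟩ := exists_subseq_tendsto_kobayashiEmbedding hyp o (u ∘ ns)
    have hφ' := hns'.comp hφ.tendsto_atTop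
    have hmem : η ∈ horoLimitSet hyp K x := by
      refine ⟨not_mem_range_kobayashiEmbedding_of_tendsto hyp (l := map (u ∘ ns ∘ φ) atTop) ?_
        (tendsto_map'_iff.2 hη), u ∘ ns ∘ φ, (tendsto_comap (f := toEndCompactification Ω K)).comp hφ', hη⟩
      exact hφ'.trans (comap_toEndCompactification_le_cocompact Ω K hx)
    rw [hξ, mem_singleton_iff] at hmem
    exact ⟨φ, hmem ▸ hη⟩
  tfae_finish
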